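/- Let $\mathfrak M$ be a von Neumann algebra on a complex Hilbert space, equipped with a normal faithful tracial state $\tau$. For self-adjoint $y\in\mathfrak M$ and a Borel set $B\subseteq\mathbb R$ let $e_B(y)\in\mathfrak M$ be the spectral projection of $y$ corresponding to $B$, and for $\lambda\in\mathbb R$ put $e_\lambda(y)=e_{(-\infty,\lambda)}(y)$ and $e_\lambda^\perp(y)=\mathbf 1-e_\lambda(y)$. A real number $m$ is called a median of a self-adjoint $x\in\mathfrak M$ if $$\tau\big(e_{(-\infty,m]}(x)\big)\ge \tfrac12\quad\text{and}\quad \tau\big(e_m^\perp(x)\big)\ge\tfrac12 .$$ For real $p\ge1$ put $\|x\|_p=\big(\tau(|x|^p)\big)^{1/p}$, and for self-adjoint $x$ put $\mathrm{var}(x)=\tau(x^2)-\tau(x)^2$. **Proposition 2.2 (properties of the median).** Let $x\in\mathfrak M$ be self-adjoint and let $\mathrm{med}(x)$ be any median of $x$. Then: (i) for every real $\alpha>0$, if $\tau\big(e_\alpha^\perp(|x|)\big)<\tfrac12$, then $|\mathrm{med}(x)|\le\alpha$; (ii) for every real $p\ge1$, $|\mathrm{med}(x)|\le 2^{1/p}\,\|x\|_p$;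 (iii) $|\mathrm{med}(x)-\tau(x)|\le\sqrt{2\,\mathrm{var}(x)}$. -/

import Mathlib

open MeasureTheory Filter Topology
open scoped InnerProductSpace CompactlySupported

/-! ## Spectral measure of a bounded self-adjoint operator -/

section SpectralMeasure

variable {H : Type*} [NormedAddCommGroup H] [InnerProductSpace ℂ H] [CompleteSpace H]

/-- The positive functional `f ↦ ⟨f(T) ξ, ξ⟩` on the continuous functions on the spectrum of the
self-adjoint operator `T`, where `f(T)` is given by the continuous functional calculus. -/
noncomputable def spectralFunctional (T : H →L[ℂ] H) (hT : IsSelfAdjoint T) (ξ : H) :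
    C_c(spectrum ℝ T, ℝ) →ₚ[ℝ] ℝ :=
  PositiveLinearMap.mk₀
    { toFun := fun f => (⟪cfcHom hT f.toContinuousMap ξ, ξ⟫_ℂ).re
      map_add' := by
        intro f g
        have : (f + g).toContinuousMap = f.toContinuousMap + g.toContinuousMap := rfl
        rw [this, map_add]
        simp
      map_smul' := by
        intro c f
        have : (c • f).toContinuousMap = c • f.toContinuousMap := rfl
        rw [this, map_smul]
        simp [← Complex.coe_smul, mul_comm] }
    (by
      intro f hf
      have h : 0 ≤ cfcHom hT f.toContinuousMap := by
        rw [cfcHom_nonneg_iff]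
        exact fun x => hf x
      rw [ContinuousLinearMap.nonneg_iff_isPositive] at h
      exact h.re_inner_nonneg_left ξ)

open Classical in
/-- The scalar spectral measure `μ_ξ` of the operator `T` at the vector `ξ`: for a self-adjoint
`T` it is the finite Borel measure on `ℝ`, carried by the spectrum of `T`, with
`∫ f dμ_ξ = ⟨f(T) ξ, ξ⟩` for all continuous `f` (it comes from the Riesz representation theorem on
the compact set `σ(T)`). -/
noncomputable def scalarSpectralMeasure (T : H →L[ℂ] H) (ξ : H) : Measure ℝ :=
  if hT : IsSelfAdjoint T then
    (RealRMK.rieszMeasure (spectralFunctional T hT ξ)).map Subtype.val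
  else 0

instance scalarSpectralMeasure.isFiniteMeasure (T : H →L[ℂ] H) (ξ : H) :
    IsFiniteMeasure (scalarSpectralMeasure T ξ) := by
  unfold scalarSpectralMeasure
  split_ifs with hT
  · have : IsFiniteMeasure (RealRMK.rieszMeasure (spectralFunctional T hT ξ)) :=
      inferInstance
    infer_instance
  · infer_instance

theorem inner_cfc_self (T : H →L[ℂ] H) (f : ℝ → ℝ) (ξ : H) :
    ((⟪cfc f T ξ, ξ⟫_ℂ).re : ℂ) = ⟪cfc f T ξ, ξ⟫_ℂ := by
  have h : IsSelfAdjoint (cfc f T) := cfc_predicate f T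
  rw [← Complex.conj_eq_iff_re, inner_conj_symm]
  exact ((ContinuousLinearMap.isSelfAdjoint_iff_isSymmetric.mp h) ξ ξ).symm

theorem integral_scalarSpectralMeasure (T : H →L[ℂ] H) (hT : IsSelfAdjoint T) (ξ : H)
    (f : ℝ → ℝ) (hf : Continuous f) :
    ((∫ t, f t ∂(scalarSpectralMeasure T ξ) : ℝ) : ℂ) = ⟪cfc f T ξ, ξ⟫_ℂ := by
  rw [← inner_cfc_self]
  congr 1
  rw [scalarSpectralMeasure, dif_pos hT]
  rw [integral_map measurable_subtype_coe.aemeasurable hf.aestronglyMeasurable]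
  let g : C_c(spectrum ℝ T, ℝ) :=
    { toFun := fun s => f s
      continuous_toFun := by fun_prop
      hasCompactSupport' := HasCompactSupport.of_compactSpace _ }
  have := RealRMK.integral_rieszMeasure (spectralFunctional T hT ξ) g
  rw [cfc_apply f T hT hf.continuousOn]
  exact this

/-- Indicators of Borel sets are approximated by continuous functions with values in `[0, 1]`,
simultaneously for finitely many scalar spectral measures. -/
theorem exists_continuous_approx (T : H →L[ℂ] H) {B : Set ℝ} (hB : MeasurableSet B)
    (s : Finset H) (n : ℕ) :
    ∃ f : ℝ → ℝ, Continuous f ∧ (∀ t, |f t| ≤ 1) ∧ ∀ ξ ∈ s,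
      |(∫ t, f t ∂(scalarSpectralMeasure T ξ)) - (scalarSpectralMeasure T ξ).real B|
        ≤ 1 / ((n : ℝ) + 1) := by
  have hfin : IsFiniteMeasure (∑ ξ ∈ s, scalarSpectralMeasure T ξ) := inferInstance
  have hint : Integrable (B.indicator (fun _ => (1 : ℝ)))
      (∑ ξ ∈ s, scalarSpectralMeasure T ξ) :=
    (integrable_const 1).indicator hB
  obtain ⟨g, hg, hgi⟩ := hint.exists_boundedContinuous_integral_sub_le
    (ε := 1 / ((n : ℝ) + 1)) (by positivity)
  have hcont : Continuous fun t => max (-1) (min 1 (g t)) := by fun_prop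
  have hbd : ∀ t, |max (-1) (min 1 (g t))| ≤ 1 := by
    intro t
    rw [abs_le]
    exact ⟨le_max_left _ _, max_le (by norm_num) (min_le_left _ _)⟩
  refine ⟨fun t => max (-1) (min 1 (g t)), hcont, hbd, fun ξ hξ => ?_⟩
  have hle : scalarSpectralMeasure T ξ ≤ ∑ ξ ∈ s, scalarSpectralMeasure T ξ :=
    Finset.single_le_sum (f := fun ξ => scalarSpectralMeasure T ξ)
      (fun _ _ => Measure.zero_le _) hξ
  have hfi : Integrable (fun t => max (-1) (min 1 (g t))) (scalarSpectralMeasure T ξ) :=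
    (integrable_const (1 : ℝ)).mono' hcont.aestronglyMeasurable
      (Eventually.of_forall hbd)
  have hind : Integrable (B.indicator (fun _ => (1 : ℝ))) (scalarSpectralMeasure T ξ) :=
    (integrable_const 1).indicator hB
  have hgξ : Integrable (fun t => ‖B.indicator (fun _ => (1 : ℝ)) t - g t‖)
      (∑ ξ ∈ s, scalarSpectralMeasure T ξ) := (hint.sub hgi).norm
  rw [← integral_indicator_one hB, abs_sub_comm]
  change |(∫ t, B.indicator (fun _ => (1 : ℝ)) t ∂_) - _| ≤ _
  rw [← integral_sub hind hfi]
  refine (abs_integral_le_integral_abs).trans (le_trans ?_ hg)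
  refine le_trans (integral_mono (hind.sub hfi).abs (hgξ.mono_measure hle) ?_)
    (integral_mono_measure hle (Eventually.of_forall fun _ => norm_nonneg _) hgξ)
  intro t
  simp only [Real.norm_eq_abs]
  have aux : ∀ c a : ℝ, -1 ≤ c → c ≤ 1 → |c - max (-1) (min 1 a)| ≤ |c - a| := by
    intro c a h1 h2
    rcases le_total a (-1) with h | h
    · rw [min_eq_right (h.trans (by norm_num)), max_eq_left h,
        abs_of_nonneg (by linarith), abs_of_nonneg (by linarith)]
      linarith
    · rcases le_total 1 a with h' | h'
      · rw [min_eq_left h', max_eq_right (by norm_num),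
          abs_of_nonpos (by linarith), abs_of_nonpos (by linarith)]
        linarith
      · rw [min_eq_right h', max_eq_right h]
  by_cases ht : t ∈ B
  · simp only [Set.indicator_of_mem ht]
    exact aux 1 (g t) (by norm_num) le_rfl
  · simp only [Set.indicator_of_notMem ht]
    exact aux 0 (g t) (by norm_num) (by norm_num)

/-- For a self-adjoint `T` and a Borel set `B` there is an operator `P` with
`⟨P ξ, ξ⟩ = μ_ξ(B)` for all `ξ`; it is a weak limit of operators `f(T)`, `f` continuous. -/
theorem exists_spectralProjection (T : H →L[ℂ] H) (hT : IsSelfAdjoint T) {B : Set ℝ}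
    (hB : MeasurableSet B) :
    ∃ P : H →L[ℂ] H, (∀ ξ, ⟪P ξ, ξ⟫_ℂ = ((scalarSpectralMeasure T ξ).real B : ℂ)) ∧
      ∃ f : Finset H × ℕ → ℝ → ℝ, (∀ i, Continuous (f i)) ∧
        ∀ η ξ, Tendsto (fun i => ⟪cfc (f i) T η, ξ⟫_ℂ) atTop (𝓝 ⟪P η, ξ⟫_ℂ) := by
  classical
  choose f hfc hf1 hfa using fun i : Finset H × ℕ => exists_continuous_approx T hB i.1 i.2
  have hq : ∀ ξ, Tendsto (fun i => ⟪cfc (f i) T ξ, ξ⟫_ℂ) atTop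
      (𝓝 ((scalarSpectralMeasure T ξ).real B : ℂ)) := by
    intro ξ
    simp_rw [← integral_scalarSpectralMeasure T hT ξ _ (hfc _)]
    refine (Complex.continuous_ofReal.tendsto _).comp ?_
    rw [tendsto_iff_dist_tendsto_zero]
    have hz : Tendsto (fun i : Finset H × ℕ => 1 / ((i.2 : ℝ) + 1)) atTop (𝓝 0) := by
      have := tendsto_one_div_add_atTop_nhds_zero_nat (𝕜 := ℝ)
      refine this.comp ?_
      rw [← prod_atTop_atTop_eq]
      exact tendsto_snd
    refine squeeze_zero' (Eventually.of_forall fun _ => dist_nonneg) ?_ hz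
    filter_upwards [eventually_ge_atTop (({ξ} : Finset H), 0)] with i hi
    rw [Real.dist_eq]
    exact hfa i ξ (hi.1 (Finset.mem_singleton_self ξ))
  have hex : ∀ η ξ, ∃ c : ℂ, Tendsto (fun i => ⟪cfc (f i) T η, ξ⟫_ℂ) atTop (𝓝 c) := by
    intro η ξ
    have key : ∀ i, ⟪cfc (f i) T η, ξ⟫_ℂ = _ :=
      fun i => inner_map_polarization ((cfc (f i) T).toLinearMap) ξ η
    simp_rw [key]
    exact ⟨_, ((((hq (ξ + η)).sub (hq (ξ - η))).add
      ((hq (ξ + Complex.I • η)).const_mul Complex.I)).sub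
      ((hq (ξ - Complex.I • η)).const_mul Complex.I)).div_const 4⟩
  choose S hS using hex
  have hbound : ∀ i, ‖cfc (f i) T‖ ≤ 1 := fun i =>
    norm_cfc_le zero_le_one fun t _ => hf1 i t
  let S' : H →ₗ⋆[ℂ] H →ₗ[ℂ] ℂ := LinearMap.mk₂'ₛₗ (starRingEnd ℂ) (RingHom.id ℂ) S
    (fun a b c => tendsto_nhds_unique (hS (a + b) c)
      (by simpa [inner_add_left] using (hS a c).add (hS b c)))
    (fun k a c => tendsto_nhds_unique (hS (k • a) c)
      (by simpa [inner_smul_left, mul_comm] using (hS a c).const_mul ((starRingEnd ℂ) k)))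
    (fun a b c => tendsto_nhds_unique (hS a (b + c))
      (by simpa [inner_add_right] using (hS a b).add (hS a c)))
    (fun k a c => tendsto_nhds_unique (hS a (k • c))
      (by simpa [inner_smul_right] using (hS a c).const_mul k))
  have hS'bd : ∀ η ξ, ‖S' η ξ‖ ≤ 1 * ‖η‖ * ‖ξ‖ := by
    intro η ξ
    refine le_of_tendsto (hS η ξ).norm (Eventually.of_forall fun i => ?_)
    refine (norm_inner_le_norm _ _).trans ?_
    gcongr
    exact (cfc (f i) T).le_of_opNorm_le (hbound i) η
  let S'' := LinearMap.mkContinuous₂ S' 1 hS'bd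
  have hP : ∀ η ξ, ⟪InnerProductSpace.continuousLinearMapOfBilin S'' η, ξ⟫_ℂ = S η ξ := by
    intro η ξ
    rw [InnerProductSpace.continuousLinearMapOfBilin_apply]
    rfl
  refine ⟨InnerProductSpace.continuousLinearMapOfBilin S'', fun ξ => ?_, f, hfc, fun η ξ => ?_⟩
  · rw [hP]
    exact tendsto_nhds_unique (hS ξ ξ) (hq ξ)
  · rw [hP]
    exact hS η ξ

open Classical in
/-- The spectral measure `E` of a self-adjoint operator `T`: for a Borel set `B`, `E(B)` is the
unique operator with `⟨E(B) ξ, ξ⟩ = μ_ξ(B)` for all `ξ`. (The value is `0` when `T` is not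
self-adjoint or `B` is not a Borel set.) -/
noncomputable def spectralProjection (T : H →L[ℂ] H) (B : Set ℝ) : H →L[ℂ] H :=
  if h : IsSelfAdjoint T ∧ MeasurableSet B then
    (exists_spectralProjection T h.1 h.2).choose
  else 0

theorem inner_spectralProjection (T : H →L[ℂ] H) (hT : IsSelfAdjoint T) {B : Set ℝ}
    (hB : MeasurableSet B) (ξ : H) :
    ⟪spectralProjection T B ξ, ξ⟫_ℂ = ((scalarSpectralMeasure T ξ).real B : ℂ) := by
  rw [spectralProjection, dif_pos ⟨hT, hB⟩]
  exact (exists_spectralProjection T hT hB).choose_spec.1 ξ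

/-- The spectral projections of `T` commute with every operator that commutes with `T`. -/
theorem commute_spectralProjection (T : H →L[ℂ] H) (B : Set ℝ) {y : H →L[ℂ] H}
    (hy : Commute T y) : Commute (spectralProjection T B) y := by
  classical
  rw [spectralProjection]
  split_ifs with h
  · obtain ⟨-, f, hf, hlim⟩ := (exists_spectralProjection T h.1 h.2).choose_spec
    set P := (exists_spectralProjection T h.1 h.2).choose
    ext η
    refine ext_inner_right ℂ fun ξ => ?_
    have h1 := hlim (y η) ξ
    have h2 := hlim η (ContinuousLinearMap.adjoint y ξ)
    simp only [ContinuousLinearMap.adjoint_inner_right] at h2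
    refine tendsto_nhds_unique h1 (h2.congr fun i => ?_)
    have hc : Commute (cfc (f i) T) y := hy.cfc_real (f i)
    congr 1
    exact (DFunLike.congr_fun hc.eq η).symm
  · exact Commute.zero_left y

end SpectralMeasure

/-! ## Noncommutative probability spaces -/

section NoncommutativeProbability

variable {H : Type*} [NormedAddCommGroup H] [InnerProductSpace ℂ H] [CompleteSpace H]

/-- An operator that commutes with everything that commutes with an element `a` of a von Neumann
algebra and with its adjoint belongs to the algebra. -/
theorem VonNeumannAlgebra.mem_of_commute (M : VonNeumannAlgebra H) {a b : H →L[ℂ] H}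
    (ha : a ∈ M.toStarSubalgebra)
    (h : ∀ y, Commute a y → Commute (star a) y → Commute b y) : b ∈ M.toStarSubalgebra := by
  have hc : b ∈ Set.centralizer (Set.centralizer (M : Set (H →L[ℂ] H))) := by
    intro y hy
    exact (h y (hy a ha) (hy (star a) (star_mem ha))).eq.symm
  rw [M.centralizer_centralizer] at hc
  exact hc

/-- A normal faithful tracial state `τ` on the von Neumann algebra `M`. Positivity says
`τ(a* a) ∈ [0, ∞)`. Normality: `τ` preserves
the suprema of upward directed sets of self-adjoint elements (in the Loewner order). -/
structure IsNormalFaithfulTracialState (M : VonNeumannAlgebra H)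
    (τ : M.toStarSubalgebra →ₗ[ℂ] ℂ) : Prop where
  re_nonneg : ∀ a, 0 ≤ (τ (star a * a)).re
  im_eq_zero : ∀ a, (τ (star a * a)).im = 0
  map_one : τ 1 = 1
  map_mul_comm : ∀ a b, τ (a * b) = τ (b * a)
  faithful : ∀ a, τ (star a * a) = 0 → a = 0
  normal : ∀ (S : Set M.toStarSubalgebra) (a : M.toStarSubalgebra), S.Nonempty →
    (∀ b ∈ S, IsSelfAdjoint b) →
    DirectedOn (fun b c : M.toStarSubalgebra => (b : H →L[ℂ] H) ≤ (c : H →L[ℂ] H)) S →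
    IsLUB ((fun b : M.toStarSubalgebra => (b : H →L[ℂ] H)) '' S) (a : H →L[ℂ] H) →
    IsLUB ((fun b => (τ b).re) '' S) (τ a).re

namespace VonNeumannAlgebra

variable (M : VonNeumannAlgebra H)

/-- The spectral projection `e_B(x)`, as an element of `M`. -/
noncomputable def specProj (x : M.toStarSubalgebra) (B : Set ℝ) : M.toStarSubalgebra :=
  ⟨spectralProjection (x : H →L[ℂ] H) B,
    M.mem_of_commute x.2 fun _ h _ => commute_spectralProjection _ B h⟩

/-- The resolution of the identity `e_r(x) = e_{(-∞, r)}(x)`. -/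
noncomputable def resolution (x : M.toStarSubalgebra) (r : ℝ) : M.toStarSubalgebra :=
  M.specProj x (Set.Iio r)

/-- The absolute value `|x| = (x* x)^{1/2}`, as an element of `M`. -/
noncomputable def absVal (x : M.toStarSubalgebra) : M.toStarSubalgebra :=
  ⟨CFC.abs (x : H →L[ℂ] H), M.mem_of_commute x.2 fun _ h h' =>
    h.cfcAbs_left (commute_star_comm.mp (by simpa using h'))⟩

/-- The power `|x| ^ p`, as an element of `M`. -/
noncomputable def absPow (x : M.toStarSubalgebra) (p : ℝ) : M.toStarSubalgebra :=
  ⟨(M.absVal x : H →L[ℂ] H) ^ p, M.mem_of_commute (M.absVal x).2 fun _ h _ =>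
    h.cfc_nnreal _⟩

/-- The norm `‖x‖_p = (τ(|x|^p))^{1/p}`, for real `p ≥ 1`. -/
noncomputable def lpNorm (τ : M.toStarSubalgebra →ₗ[ℂ] ℂ) (p : ℝ) (x : M.toStarSubalgebra) : ℝ :=
  ((τ (M.absPow x p)).re) ^ (1 / p)

/-- The variance `var(x) = τ(x²) - τ(x)²` of a self-adjoint element. -/
noncomputable def variance (τ : M.toStarSubalgebra →ₗ[ℂ] ℂ) (x : M.toStarSubalgebra) : ℝ :=
  (τ (x ^ 2) - τ x ^ 2).re

/-- `m` is a median of the self-adjoint element `x`: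
`τ(e_{(-∞, m]}(x)) ≥ 1/2` and `τ(e_m^⊥(x)) ≥ 1/2`, where `e^⊥ = 1 - e`. -/
structure IsMedian (τ : M.toStarSubalgebra →ₗ[ℂ] ℂ) (x : M.toStarSubalgebra) (m : ℝ) : Prop where
  lower : 1 / 2 ≤ (τ (M.specProj x (Set.Iic m))).re
  upper : 1 / 2 ≤ (τ (1 - M.resolution x m)).re

end VonNeumannAlgebra

end NoncommutativeProbability

/-! ### Operator inequalities from pointwise inequalities on the real line -/

section SpectralOrder

variable {H : Type*} [NormedAddCommGroup H] [InnerProductSpace ℂ H] [CompleteSpace H]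

/-! All three bounds are one Markov inequality. Let `f ≥ 0` be continuous with `f ≥ c ≥ 0` on one of
the closed half-lines ending at the median `m`, and let `B` be that half-line. Then `c · 1_B ≤ f`
pointwise, hence `c • e_B(x) ≤ f(x)` as operators, and the trace gives `c / 2 ≤ τ(f(x))`, since
`τ(e_B(x)) ≥ 1/2` by the definition of a median (`half_mul_le_of_median`).

Part (ii) is `f(t) = |t|^p`, `c = |m|^p`; part (iii) is `f(t) = (t - τ(x))²`, `c = (m - τ(x))²`. For
(i), if `α < |m|`, a continuous ramp `g` from `α` to `|m|` gives `1/2 ≤ τ(g(|x|)) ≤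
τ(e_[α,∞)(|x|))`, a contradiction. The sign of `m`, or of `m - τ(x)`, selects the half-line.

Pointwise inequalities pass to operators because quadratic forms of `f(T)` and `e_B(T)` are
integrals against the same scalar spectral measure (`smul_spectralProjection_le_cfc`,
`cfc_le_spectralProjection`). -/

theorem integrable_scalarSpectralMeasure (T : H →L[ℂ] H) (ξ : H) {f : ℝ → ℝ}
    (hf : Continuous f) : Integrable f (scalarSpectralMeasure T ξ) := by
  unfold scalarSpectralMeasure
  split_ifs with hT
  · rw [integrable_map_measure hf.aestronglyMeasurable measurable_subtype_coe.aemeasurable]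
    -- `f` may be unbounded on `ℝ`, but the measure lives on the compact spectrum.
    exact (hf.comp continuous_subtype_val).integrable_of_hasCompactSupport
      (HasCompactSupport.of_compactSpace _)
  · exact integrable_zero_measure

theorem re_inner_cfc (T : H →L[ℂ] H) (hT : IsSelfAdjoint T) (ξ : H) {f : ℝ → ℝ}
    (hf : Continuous f) :
    (⟪cfc f T ξ, ξ⟫_ℂ).re = ∫ t, f t ∂(scalarSpectralMeasure T ξ) := by
  rw [← integral_scalarSpectralMeasure T hT ξ f hf, Complex.ofReal_re]

theorem re_inner_spectralProjection (T : H →L[ℂ] H) (hT : IsSelfAdjoint T) {B : Set ℝ}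
    (hB : MeasurableSet B) (ξ : H) :
    (⟪spectralProjection T B ξ, ξ⟫_ℂ).re = (scalarSpectralMeasure T ξ).real B := by
  rw [inner_spectralProjection T hT hB, Complex.ofReal_re]

theorem isSelfAdjoint_spectralProjection (T : H →L[ℂ] H) (hT : IsSelfAdjoint T) {B : Set ℝ}
    (hB : MeasurableSet B) : IsSelfAdjoint (spectralProjection T B) := by
  rw [ContinuousLinearMap.isSelfAdjoint_iff_isSymmetric,
    LinearMap.isSymmetric_iff_inner_map_self_real]
  intro ξ
  change (starRingEnd ℂ) ⟪spectralProjection T B ξ, ξ⟫_ℂ = ⟪spectralProjection T B ξ, ξ⟫_ℂ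
  rw [inner_spectralProjection T hT hB, Complex.conj_ofReal]

/-- Self-adjoint operators are compared through their quadratic forms. -/
theorem IsSelfAdjoint.le_of_re_inner_le {S T : H →L[ℂ] H} (hS : IsSelfAdjoint S)
    (hT : IsSelfAdjoint T) (h : ∀ ξ, (⟪S ξ, ξ⟫_ℂ).re ≤ (⟪T ξ, ξ⟫_ℂ).re) : S ≤ T := by
  rw [ContinuousLinearMap.le_def, ContinuousLinearMap.isPositive_def']
  refine ⟨hT.sub hS, fun ξ => ?_⟩
  rw [ContinuousLinearMap.reApplyInnerSelf_apply]
  simpa [inner_sub_left] using h ξ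

theorem smul_spectralProjection_le_cfc (T : H →L[ℂ] H) (hT : IsSelfAdjoint T) {B : Set ℝ}
    (hB : MeasurableSet B) {c : ℝ} {f : ℝ → ℝ} (hf : Continuous f)
    (h : ∀ t, B.indicator (fun _ => c) t ≤ f t) :
    c • spectralProjection T B ≤ cfc f T := by
  refine ((IsSelfAdjoint.all c).smul
    (isSelfAdjoint_spectralProjection T hT hB)).le_of_re_inner_le
    (cfc_predicate f T) fun ξ => ?_
  have hl : (⟪(c • spectralProjection T B) ξ, ξ⟫_ℂ).re
      = c * (scalarSpectralMeasure T ξ).real B := by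
    rw [← re_inner_spectralProjection T hT hB]
    simp [← Complex.coe_smul, mul_comm]
  have hr : c * (scalarSpectralMeasure T ξ).real B
      = ∫ t, B.indicator (fun _ => c) t ∂(scalarSpectralMeasure T ξ) := by
    rw [integral_indicator_const c hB, smul_eq_mul, mul_comm]
  rw [hl, hr, re_inner_cfc T hT ξ hf]
  exact integral_mono ((integrable_const c).indicator hB)
    (integrable_scalarSpectralMeasure T ξ hf) h

theorem cfc_le_spectralProjection (T : H →L[ℂ] H) (hT : IsSelfAdjoint T) {B : Set ℝ}
    (hB : MeasurableSet B) {f : ℝ → ℝ} (hf : Continuous f)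
    (h : ∀ t, f t ≤ B.indicator (fun _ => 1) t) :
    cfc f T ≤ spectralProjection T B := by
  refine IsSelfAdjoint.le_of_re_inner_le (cfc_predicate f T)
    (isSelfAdjoint_spectralProjection T hT hB) fun ξ => ?_
  rw [re_inner_spectralProjection T hT hB, re_inner_cfc T hT ξ hf, ← integral_indicator_one hB]
  exact integral_mono (integrable_scalarSpectralMeasure T ξ hf)
    ((integrable_const 1).indicator hB) h

/-- Over `ℂ` the quadratic form determines the operator, so this is additivity of the spectral
measure; its total mass is `⟪ξ, ξ⟫`, by integrating the constant `1`. -/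
theorem one_sub_spectralProjection (T : H →L[ℂ] H) (hT : IsSelfAdjoint T) {B : Set ℝ}
    (hB : MeasurableSet B) : 1 - spectralProjection T B = spectralProjection T Bᶜ := by
  refine ContinuousLinearMap.coe_inj.mp ((ext_inner_map _ _).mp fun ξ => ?_)
  have h1 := integral_scalarSpectralMeasure T hT ξ (fun _ => 1) continuous_const
  rw [cfc_const_one ℝ T] at h1
  have h2 := measureReal_compl (μ := scalarSpectralMeasure T ξ) hB
  simp only [integral_const, smul_eq_mul, mul_one] at h1
  change ⟪(1 - spectralProjection T B) ξ, ξ⟫_ℂ = ⟪spectralProjection T Bᶜ ξ, ξ⟫_ℂ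
  rw [inner_spectralProjection T hT hB.compl, h2, sub_apply, inner_sub_left,
    inner_spectralProjection T hT hB, ← h1, Complex.ofReal_sub]

theorem cfcAbs_rpow_eq_cfc (T : H →L[ℂ] H) (hT : IsSelfAdjoint T) {p : ℝ} (hp : 0 ≤ p) :
    CFC.abs T ^ p = cfc (fun t : ℝ => |t| ^ p) T := by
  rw [CFC.rpow_eq_cfc_real (CFC.abs_nonneg T), CFC.abs_eq_cfc_norm T hT,
    ← cfc_comp' (fun t : ℝ => t ^ p) (fun t : ℝ => ‖t‖) T
      (Real.continuous_rpow_const hp).continuousOn]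
  rfl

end SpectralOrder

/-! ### Monotonicity of the trace and the median inequalities -/

section TracialState

variable {H : Type*} [NormedAddCommGroup H] [InnerProductSpace ℂ H] [CompleteSpace H]
variable {M : VonNeumannAlgebra H} {τ : M.toStarSubalgebra →ₗ[ℂ] ℂ}

theorem VonNeumannAlgebra.isSelfAdjoint_coe {x : M.toStarSubalgebra} (hx : IsSelfAdjoint x) :
    IsSelfAdjoint (x : H →L[ℂ] H) :=
  congrArg Subtype.val hx.star_eq

theorem VonNeumannAlgebra.one_sub_resolution {x : M.toStarSubalgebra} (hx : IsSelfAdjoint x)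
    (r : ℝ) : 1 - M.resolution x r = M.specProj x (Set.Ici r) := by
  refine Subtype.ext ?_
  rw [← Set.compl_Iio]
  exact one_sub_spectralProjection _ (isSelfAdjoint_coe hx) measurableSet_Iio

namespace IsNormalFaithfulTracialState

/-- Positivity of `τ` is postulated only on products `s* s`; the square root of `a` commutes with
all that commutes with `a`, so it lies in `M` and serves as `s`. -/
theorem re_nonneg_of_nonneg (hτ : IsNormalFaithfulTracialState M τ) {a : M.toStarSubalgebra}
    (ha : 0 ≤ (a : H →L[ℂ] H)) : 0 ≤ (τ a).re := by
  let s : M.toStarSubalgebra := ⟨CFC.sqrt (a : H →L[ℂ] H),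
    M.mem_of_commute a.2 fun _ h _ => h.cfcₙ_nnreal _⟩
  have hs : star s * s = a := by
    refine Subtype.ext ?_
    change star (CFC.sqrt (a : H →L[ℂ] H)) * CFC.sqrt (a : H →L[ℂ] H) = a
    rw [(CFC.sqrt_nonneg (a : H →L[ℂ] H)).isSelfAdjoint.star_eq, CFC.sqrt_mul_sqrt_self _ ha]
  rw [← hs]
  exact hτ.re_nonneg s

theorem re_mono (hτ : IsNormalFaithfulTracialState M τ) {a b : M.toStarSubalgebra}
    (h : (a : H →L[ℂ] H) ≤ b) : (τ a).re ≤ (τ b).re := by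
  have := hτ.re_nonneg_of_nonneg (a := b - a) (sub_nonneg.mpr h)
  rw [map_sub, Complex.sub_re] at this
  linarith

theorem im_eq_zero_of_isSelfAdjoint (hτ : IsNormalFaithfulTracialState M τ)
    {x : M.toStarSubalgebra} (hx : IsSelfAdjoint x) : (τ x).im = 0 := by
  -- Reality is known only on squares, and `2x = (x + 1)² - x² - 1`.
  have h1 := hτ.im_eq_zero (x + 1)
  have h2 := hτ.im_eq_zero x
  have h : star (x + 1) * (x + 1) = star x * x + (x + x) + 1 := by
    rw [star_add, star_one, hx.star_eq]
    noncomm_ring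
  rw [h, map_add, map_add, map_add, hτ.map_one] at h1
  simp only [Complex.add_im, Complex.one_im, h2] at h1
  linarith

/-- Markov's inequality for spectral projections. -/
theorem mul_re_specProj_le (hτ : IsNormalFaithfulTracialState M τ) {x a : M.toStarSubalgebra}
    (hx : IsSelfAdjoint x) {B : Set ℝ} (hB : MeasurableSet B) {c : ℝ} {f : ℝ → ℝ}
    (hf : Continuous f) (ha : (a : H →L[ℂ] H) = cfc f (x : H →L[ℂ] H))
    (h : ∀ t, B.indicator (fun _ => c) t ≤ f t) :
    c * (τ (M.specProj x B)).re ≤ (τ a).re := by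
  have hle : (((c : ℂ) • M.specProj x B : M.toStarSubalgebra) : H →L[ℂ] H) ≤ a := by
    rw [ha]
    refine le_of_eq_of_le ?_ (smul_spectralProjection_le_cfc (x : H →L[ℂ] H)
      (VonNeumannAlgebra.isSelfAdjoint_coe hx) hB hf h)
    exact Complex.coe_smul c (spectralProjection (x : H →L[ℂ] H) B)
  simpa using hτ.re_mono hle

theorem half_mul_le_of_median (hτ : IsNormalFaithfulTracialState M τ) {x a : M.toStarSubalgebra}
    (hx : IsSelfAdjoint x) {m : ℝ} (hm : M.IsMedian τ x m) {c : ℝ} (hc : 0 ≤ c) {f : ℝ → ℝ}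
    (hf : Continuous f) (ha : (a : H →L[ℂ] H) = cfc f (x : H →L[ℂ] H)) (hf0 : ∀ t, 0 ≤ f t)
    (h : (∀ t, m ≤ t → c ≤ f t) ∨ ∀ t, t ≤ m → c ≤ f t) : 1 / 2 * c ≤ (τ a).re := by
  rcases h with h | h
  · have hu := hm.upper
    rw [VonNeumannAlgebra.one_sub_resolution hx] at hu
    nlinarith [hτ.mul_re_specProj_le hx measurableSet_Ici hf ha
      (Set.indicator_le' (s := Set.Ici m) h fun t _ => hf0 t)]
  · nlinarith [hm.lower, hτ.mul_re_specProj_le hx measurableSet_Iic hf ha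
      (Set.indicator_le' (s := Set.Iic m) h fun t _ => hf0 t)]

theorem abs_median_le_of_tail (hτ : IsNormalFaithfulTracialState M τ) {x : M.toStarSubalgebra}
    (hx : IsSelfAdjoint x) {m : ℝ} (hm : M.IsMedian τ x m) {α : ℝ}
    (hα : (τ (1 - M.resolution (M.absVal x) α)).re < 1 / 2) : |m| ≤ α := by
  by_contra! hlt
  have hd : 0 < |m| - α := sub_pos.mpr hlt
  have hx' := VonNeumannAlgebra.isSelfAdjoint_coe hx
  have habs : IsSelfAdjoint (M.absVal x) :=
    Subtype.ext (CFC.abs_nonneg (x : H →L[ℂ] H)).isSelfAdjoint.star_eq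
  rw [VonNeumannAlgebra.one_sub_resolution habs] at hα
  -- The ramp is `0` up to `α` and `1` from `|m|` on. As `g(|x|)` is a continuous function of `x` as
  -- well as of `|x|`, spectral projections of `|x|` and of `x` need not be related directly.
  let g : ℝ → ℝ := fun t => max 0 (min 1 ((t - α) / (|m| - α)))
  have hg : Continuous g := by fun_prop
  let a : M.toStarSubalgebra := ⟨cfc g (M.absVal x : H →L[ℂ] H),
    M.mem_of_commute (M.absVal x).2 fun _ h _ => h.cfc_real g⟩
  have ha : (a : H →L[ℂ] H) = cfc (fun t => g |t|) (x : H →L[ℂ] H) := by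
    change cfc g (CFC.abs (x : H →L[ℂ] H)) = _
    rw [CFC.abs_eq_cfc_norm _ hx', ← cfc_comp' g (fun t : ℝ => ‖t‖) _ hg.continuousOn]
    rfl
  have hle : (a : H →L[ℂ] H) ≤ M.specProj (M.absVal x) (Set.Ici α) := by
    refine cfc_le_spectralProjection _ (VonNeumannAlgebra.isSelfAdjoint_coe habs)
      measurableSet_Ici hg fun t => ?_
    by_cases ht : t ∈ Set.Ici α
    · rw [Set.indicator_of_mem ht]
      exact max_le zero_le_one (min_le_left _ _)
    · rw [Set.indicator_of_notMem ht]
      rw [Set.mem_Ici, not_le] at ht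
      exact max_le le_rfl ((min_le_right _ _).trans
        (div_nonpos_of_nonpos_of_nonneg (by linarith) hd.le))
  have hone : ∀ t, |m| ≤ |t| → 1 ≤ g |t| := fun t ht =>
    le_max_of_le_right (le_min le_rfl ((one_le_div hd).mpr (by linarith)))
  -- On the half-line from `m` pointing away from `0`, every `t` has `|t| ≥ |m|`.
  have key := hτ.half_mul_le_of_median hx hm zero_le_one (hg.comp continuous_abs) ha
    (fun t => le_max_left _ _) <| (le_total 0 m).imp
      (fun h t ht => hone t (abs_le_abs_of_nonneg h ht))
      (fun h t ht => hone t (abs_le_abs_of_nonpos h ht))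
  linarith [hτ.re_mono hle]

theorem abs_median_le_lpNorm (hτ : IsNormalFaithfulTracialState M τ) {x : M.toStarSubalgebra}
    (hx : IsSelfAdjoint x) {m : ℝ} (hm : M.IsMedian τ x m) {p : ℝ} (hp : 0 < p) :
    |m| ≤ (2 : ℝ) ^ (1 / p) * M.lpNorm τ p x := by
  have ha : (M.absPow x p : H →L[ℂ] H) = cfc (fun t : ℝ => |t| ^ p) (x : H →L[ℂ] H) :=
    cfcAbs_rpow_eq_cfc _ (VonNeumannAlgebra.isSelfAdjoint_coe hx) hp.le
  have hpow : ∀ t, |m| ≤ |t| → |m| ^ p ≤ |t| ^ p := fun t ht =>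
    Real.rpow_le_rpow (abs_nonneg m) ht hp.le
  have key := hτ.half_mul_le_of_median hx hm (by positivity : (0 : ℝ) ≤ |m| ^ p)
    (continuous_abs.rpow_const fun _ => Or.inr hp.le) ha (fun t => by positivity) <|
      (le_total 0 m).imp
        (fun h t ht => hpow t (abs_le_abs_of_nonneg h ht))
        (fun h t ht => hpow t (abs_le_abs_of_nonpos h ht))
  have hpos : 0 ≤ |m| ^ p := by positivity
  rw [VonNeumannAlgebra.lpNorm, ← Real.mul_rpow zero_le_two (by linarith), one_div,
    Real.le_rpow_inv_iff_of_pos (abs_nonneg m) (by linarith) hp]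
  linarith

theorem norm_median_sub_le (hτ : IsNormalFaithfulTracialState M τ) {x : M.toStarSubalgebra}
    (hx : IsSelfAdjoint x) {m : ℝ} (hm : M.IsMedian τ x m) :
    ‖(m : ℂ) - τ x‖ ≤ √(2 * M.variance τ x) := by
  obtain ⟨r, hr⟩ : ∃ r : ℝ, τ x = r :=
    ⟨(τ x).re, Complex.ext rfl (hτ.im_eq_zero_of_isSelfAdjoint hx)⟩
  -- The variance is the trace of the centred square, because `r = τ(x)`.
  let a : M.toStarSubalgebra := (x - (r : ℂ) • 1) ^ 2
  have hτa : (τ a).re = M.variance τ x := by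
    have h : a = x ^ 2 - (2 * r : ℂ) • x + ((r : ℂ) ^ 2) • 1 := by
      simp only [a, sq, sub_mul, mul_sub, smul_mul_assoc, mul_smul_comm, one_mul, mul_one]
      module
    rw [VonNeumannAlgebra.variance, h, map_add, map_sub, map_smul, map_smul, hτ.map_one, hr]
    congr 1
    simp only [smul_eq_mul]
    ring
  have ha : (a : H →L[ℂ] H) = cfc (fun t : ℝ => (t - r) ^ 2) (x : H →L[ℂ] H) := by
    have hx' := VonNeumannAlgebra.isSelfAdjoint_coe hx
    rw [cfc_pow (fun t : ℝ => t - r) 2 _, cfc_sub (fun t : ℝ => t) (fun _ => r) _,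
      cfc_id' ℝ _, cfc_const r _, Algebra.algebraMap_eq_smul_one, ← Complex.coe_smul]
    rfl
  have key := hτ.half_mul_le_of_median hx hm (sq_nonneg (m - r)) (by fun_prop) ha
    (fun t => sq_nonneg _) <| (le_total r m).imp
      (fun h t ht => by nlinarith) (fun h t ht => by nlinarith)
  rw [hr, ← Complex.ofReal_sub, Complex.norm_real, Real.norm_eq_abs]
  exact Real.abs_le_sqrt (by linarith)

end IsNormalFaithfulTracialState

end TracialState

theorem proposition2p2 {H : Type*} [NormedAddCommGroup H] [InnerProductSpace ℂ H]
    [CompleteSpace H] (M : VonNeumannAlgebra H) (τ : M.toStarSubalgebra →ₗ[ℂ] ℂ)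
    (hτ : IsNormalFaithfulTracialState M τ) (x : M.toStarSubalgebra) (hx : IsSelfAdjoint x)
    (m : ℝ) (hm : M.IsMedian τ x m) :
    (∀ α : ℝ, 0 < α → (τ (1 - M.resolution (M.absVal x) α)).re < 1 / 2 → |m| ≤ α) ∧
    (∀ p : ℝ, 1 ≤ p → |m| ≤ (2 : ℝ) ^ (1 / p) * M.lpNorm τ p x) ∧
    ‖(m : ℂ) - τ x‖ ≤ √(2 * M.variance τ x) := by
  exact ⟨fun _ _ h => hτ.abs_median_le_of_tail hx hm h,
    fun _ hp => hτ.abs_median_le_lpNorm hx hm (zero_lt_one.trans_le hp),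
    hτ.norm_median_sub_le hx hm⟩
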